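/- For integers $k\ge 1$ and $n>2k$, let $K(n,k)$ denote the Kneser graph, whose vertices are the $k$-element subsets of $\{1,\dots,n\}$, two of them being adjacent if and only if they are disjoint. A set $S$ of vertices of a finite graph $G$ is a determining set if the identity is the only automorphism of $G$ that fixes every vertex of $S$, and the determining number $\mathrm{Det}(G)$ is the minimum cardinality of a determining set of $G$. For an integer $r$ let $f(r)$ be the number of Kneser graphs with determining number $r$, i.e. the number of pairs $(n,k)$ of integers with $k\ge 1$, $n>2k$ and $\mathrm{Det}(K(n,k))=r$; this number is finite for every $r$. Then the sequence $f(r)$ is eventually convex: for all sufficiently large $r\in\mathbb{N}$, $$f(r+1)+f(r-1)\ \ge\ 2f(r).$$ -/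

import Mathlib

/-- The Kneser graph `K(n,k)`: the vertices are the `k`-subsets of an `n`-set, two distinct vertices
being adjacent iff they are disjoint. (For `k ≥ 1` disjoint vertices are automatically distinct.) -/
def kneserGraph (n k : ℕ) : SimpleGraph {s : Finset (Fin n) // s.card = k} where
  Adj s t := s ≠ t ∧ Disjoint s.1 t.1
  symm := ⟨fun _ _ h => ⟨h.1.symm, h.2.symm⟩⟩
  loopless := ⟨fun _ h => h.1 rfl⟩

/-- A set `S` of vertices is a determining set of `G` if the only automorphism of `G` that fixes
every vertex of `S` is the identity. -/
def IsDeterminingSet {V : Type*} (G : SimpleGraph V) (S : Set V) : Prop :=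
  ∀ φ : G ≃g G, (∀ v ∈ S, φ v = v) → ∀ v, φ v = v

/-- The determining number of a graph on a finite vertex set: the minimum cardinality of a
determining set. (The set of all vertices is determining, so the minimum exists.) -/
noncomputable def determiningNumber {V : Type*} [Finite V] (G : SimpleGraph V) : ℕ :=
  sInf {m : ℕ | ∃ S : Finset V, IsDeterminingSet G (S : Set V) ∧ S.card = m}

/-- The parameters `(n, k)`, with `k ≥ 1` and `n > 2k`, of the Kneser graphs whose determining
number is `r`. -/
def kneserWithDet (r : ℕ) : Set (ℕ × ℕ) :=
  {p | 1 ≤ p.2 ∧ 2 * p.2 < p.1 ∧ determiningNumber (kneserGraph p.1 p.2) = r}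

/-- The number of Kneser graphs with determining number `r`. -/
noncomputable def numKneserWithDet (r : ℕ) : ℕ := (kneserWithDet r).ncard

/-! Let N(r) count the pairs (n, k) with determining number at most r, so that f(r) = N(r) - N(r-1).
If N(r+1) ≥ 3 N(r), then f(r+1) ≥ 2 N(r) ≥ 2 f(r), which is more than convexity. The tripling
follows from N(r) = C(2r, r)/4 + O(2^r), whose main term grows by a factor tending to 4.

Automorphisms of K(n,k) come from permutations of the ground set (`exists_perm_of_kneserGraph_iso`),
so determining means separating points. Dually, one needs n distinct subsets of an r-set with every
degree equal to k. By a balancing argument (`exists_regular_of_sum_card_le`), total size at most kr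
suffices. The least total size m of n subsets is reached by taking the smallest ones, so for fixed n
the admissible k satisfy m/r ≤ k < n/2. Up to rounding there are (rn - 2m)/(2r) of them, and the sum
over n is evaluated exactly by `two_mul_sum_excess`. -/

open Finset

/-! ### Cliques and self-maps of the Johnson graph. -/

section Johnson

variable {α : Type*} [DecidableEq α]

lemma erase_subset_of_card_union {k : ℕ} {A B : Finset α} (hA : #A = k + 1) (hB : #B = k + 1)
    (h : #(A ∪ B) = k + 2) {e : α} (heA : e ∈ A) (heB : e ∉ B) : A.erase e ⊆ B := by
  have hi : #(A ∩ B) = k := by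
    have := card_union_add_card_inter A B
    omega
  have hs : A ∩ B ⊆ A.erase e := fun x hx => by
    simp only [mem_inter, mem_erase] at hx ⊢
    exact ⟨fun hxe => heB (hxe ▸ hx.2), hx.1⟩
  have : A ∩ B = A.erase e := eq_of_subset_of_card_le hs (by rw [card_erase_of_mem heA]; omega)
  rw [← this]
  exact inter_subset_right

/-- A large clique of the Johnson graph consists of sets with a common subset of corank one. -/
lemma exists_common_subset_of_clique {k : ℕ} {F : Finset (Finset α)}
    (hcard : ∀ A ∈ F, #A = k + 1)
    (hadj : ∀ A ∈ F, ∀ B ∈ F, A ≠ B → #(A ∪ B) = k + 2) (hF : k + 2 < #F) :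
    ∃ C : Finset α, #C = k ∧ ∀ A ∈ F, C ⊆ A := by
  obtain ⟨A, hA, B, hB, hAB⟩ := one_lt_card.1 (show 1 < #F by omega)
  have hU := hadj A hA B hB hAB
  have hi : #(A ∩ B) = k := by
    have := card_union_add_card_inter A B
    have := hcard A hA
    have := hcard B hB
    omega
  refine ⟨A ∩ B, hi, ?_⟩
  by_contra! hcon
  obtain ⟨D, hD, hCD⟩ := hcon
  obtain ⟨c, hc, hcD⟩ := not_subset.1 hCD
  have hcA := (mem_inter.1 hc).1
  have hcB := (mem_inter.1 hc).2
  have key : ∀ X ∈ F, ∀ Y ∈ F, ∀ e ∈ X, e ∉ Y → X.erase e ⊆ Y := fun X hX Y hY e heX heY =>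
    erase_subset_of_card_union (hcard X hX) (hcard Y hY)
      (hadj X hX Y hY (fun h => heY (h ▸ heX))) heX heY
  have hDeq : (A ∪ B).erase c = D := by
    refine eq_of_subset_of_card_le ?_ ?_
    · rw [erase_union_distrib]
      exact union_subset (key A hA D hD c hcA hcD) (key B hB D hD c hcB hcD)
    · rw [card_erase_of_mem (mem_union_left _ hcA), hU, hcard D hD]
      omega
  -- With D equal to A ∪ B minus c, a member E not inside A ∪ B would have E minus a point inside (A
  -- ∩ B) minus c, which is too small. So F has at most k + 2 members.
  have hsub : F ⊆ powersetCard (k + 1) (A ∪ B) := by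
    intro E hE
    refine mem_powersetCard.2 ⟨fun e he => ?_, hcard E hE⟩
    by_contra heU
    have heA : e ∉ A := fun h => heU (mem_union_left _ h)
    have heB : e ∉ B := fun h => heU (mem_union_right _ h)
    have heD : e ∉ D := fun h => heU (by rw [← hDeq] at h; exact mem_of_mem_erase h)
    have h1 := key E hE A hA e he heA
    have h2 := key E hE B hB e he heB
    have h3 := key E hE D hD e he heD
    have h4 : E.erase e ⊆ (A ∩ B).erase c := fun x hx => by
      refine mem_erase.2 ⟨fun hxc => hcD (hxc ▸ h3 hx), mem_inter.2 ⟨h1 hx, h2 hx⟩⟩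
    have h5 := card_le_card h4
    rw [card_erase_of_mem he, card_erase_of_mem hc, hi, hcard E hE] at h5
    have : 0 < k := by rw [← hi]; exact card_pos.2 ⟨c, hc⟩
    omega
  have := card_le_card hsub
  rw [card_powersetCard, hU, Nat.choose_succ_self_right] at this
  omega

/-- The sets obtained from `C` by adding one element. -/
def upperStar [Fintype α] (C : Finset α) : Finset (Finset α) := Cᶜ.image fun x => insert x C

lemma mem_upperStar [Fintype α] {C A : Finset α} :
    A ∈ upperStar C ↔ C ⊆ A ∧ #A = #C + 1 := by
  simp only [upperStar, mem_image, mem_compl]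
  constructor
  · rintro ⟨x, hx, rfl⟩
    exact ⟨subset_insert _ _, card_insert_of_notMem hx⟩
  · rintro ⟨hCA, hc⟩
    have : #(A \ C) = 1 := by rw [card_sdiff_of_subset hCA]; omega
    obtain ⟨x, hx⟩ := card_eq_one.1 this
    have hx' : x ∈ A \ C := hx ▸ mem_singleton_self x
    refine ⟨x, (mem_sdiff.1 hx').2, ?_⟩
    rw [insert_eq, ← hx, sdiff_union_of_subset hCA]

lemma card_upperStar [Fintype α] (C : Finset α) : #(upperStar C) = Fintype.card α - #C := by
  rw [upperStar, card_image_of_injOn, card_compl]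
  intro x hx y hy hxy
  have hx' : x ∉ C := by simpa using hx
  have : x ∈ insert y C := by
    have h : insert x C = insert y C := hxy
    rw [← h]; exact mem_insert_self _ _
  exact (mem_insert.1 this).resolve_right hx'

lemma eq_of_upperStar_eq [Fintype α] {C D : Finset α} (hcard : #C = #D)
    (hlt : #C + 1 < Fintype.card α) (h : upperStar C = upperStar D) : C = D := by
  by_contra hne
  have hsub : ∀ A ∈ upperStar C, A = C ∪ D := fun A hA => by
    have hC := mem_upperStar.1 hA
    have hD := mem_upperStar.1 (h ▸ hA)
    refine (eq_of_subset_of_card_le (union_subset hC.1 hD.1) ?_).symm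
    rw [hC.2]
    by_contra! hlt
    have h1 : C = C ∪ D := eq_of_subset_of_card_le subset_union_left (by omega)
    have h2 : D = C ∪ D := eq_of_subset_of_card_le subset_union_right (by omega)
    exact hne (h1.trans h2.symm)
  have : #(upperStar C) ≤ 1 :=
    card_le_one.2 fun A hA B hB => (hsub A hA).trans (hsub B hB).symm
  rw [card_upperStar] at this
  omega

/-- An injective adjacency preserving self-map of the Johnson graph `J(n,k)`, where `2 * k < n`, is
induced by a permutation of the ground set. -/
theorem exists_perm_of_johnson [Fintype α] (k : ℕ) (hk : 1 ≤ k) :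
    2 * k < Fintype.card α → ∀ φ : Finset α → Finset α, (∀ A, #A = k → #(φ A) = k) →
      (∀ A B, #A = k → #B = k → φ A = φ B → A = B) →
      (∀ A B, #A = k → #B = k → #(A ∪ B) = k + 1 → #(φ A ∪ φ B) = k + 1) →
      ∃ σ : Equiv.Perm α, ∀ A, #A = k → φ A = A.map σ.toEmbedding := by
  induction k, hk using Nat.le_induction with
  | base =>
    intro _ φ hc hinj _
    have h1 : ∀ x, ∃ y, φ {x} = {y} := fun x => card_eq_one.1 (hc _ (card_singleton x))
    choose s hs using h1
    have hsinj : Function.Injective s := fun x y hxy => by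
      have := hinj {x} {y} (card_singleton x) (card_singleton y) (by rw [hs, hs, hxy])
      exact singleton_injective this
    refine ⟨Equiv.ofBijective s (Finite.injective_iff_bijective.1 hsinj), fun A hA => ?_⟩
    obtain ⟨x, rfl⟩ := card_eq_one.1 hA
    rw [hs, map_singleton]
    rfl
  | succ k hk ih =>
    intro hn φ hc hinj hadj
    -- The star of a k-set is a clique with n - k > k + 2 members, so its image has a common
    -- k-subset. This yields a map `ψ` one level down, to which induction applies.
    have hstar : ∀ C : Finset α, ∃ C' : Finset α,
        #C = k → #C' = k ∧ ∀ A ∈ upperStar C, C' ⊆ φ A := by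
      intro C
      by_cases hC : #C = k
      swap
      · exact ⟨∅, fun h => absurd h hC⟩
      have hmem : ∀ A ∈ upperStar C, #A = k + 1 := fun A hA => by
        rw [(mem_upperStar.1 hA).2, hC]
      have hci : #((upperStar C).image φ) = Fintype.card α - k := by
        rw [card_image_of_injOn, card_upperStar, hC]
        exact fun A hA B hB h => hinj A B (hmem A hA) (hmem B hB) h
      obtain ⟨C', h1, h2⟩ := exists_common_subset_of_clique (k := k)
        (F := (upperStar C).image φ) (by
          intro A hA
          obtain ⟨X, hX, rfl⟩ := mem_image.1 hA
          exact hc X (hmem X hX)) (by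
          intro A hA B hB hne
          obtain ⟨X, hX, rfl⟩ := mem_image.1 hA
          obtain ⟨Y, hY, rfl⟩ := mem_image.1 hB
          refine hadj X Y (hmem X hX) (hmem Y hY) ?_
          have hXY : X ≠ Y := fun h => hne (h ▸ rfl)
          have hi := card_le_card
            (subset_inter (mem_upperStar.1 hX).1 (mem_upperStar.1 hY).1)
          have hui := card_union_add_card_inter X Y
          have hXc := hmem X hX
          have hYc := hmem Y hY
          by_contra hcon
          have hle : #(X ∪ Y) ≤ k + 1 := by omega
          have e1 : X = X ∪ Y := eq_of_subset_of_card_le subset_union_left (by omega)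
          have e2 : Y = X ∪ Y := eq_of_subset_of_card_le subset_union_right (by omega)
          exact hXY (e1.trans e2.symm)) (by omega)
      exact ⟨C', fun _ => ⟨h1, fun A hA => h2 _ (mem_image_of_mem φ hA)⟩⟩
    choose ψ hψ using hstar
    have himg : ∀ C, #C = k → (upperStar C).image φ = upperStar (ψ C) := fun C hC => by
      have hmem : ∀ A ∈ upperStar C, #A = k + 1 := fun A hA => by
        rw [(mem_upperStar.1 hA).2, hC]
      refine eq_of_subset_of_card_le ?_ ?_
      · intro A hA
        obtain ⟨X, hX, rfl⟩ := mem_image.1 hA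
        exact mem_upperStar.2 ⟨(hψ C hC).2 X hX, by rw [hc X (hmem X hX), (hψ C hC).1]⟩
      · rw [card_image_of_injOn, card_upperStar, card_upperStar, hC, (hψ C hC).1]
        exact fun A hA B hB h => hinj A B (hmem A hA) (hmem B hB) h
    have hψinj : ∀ A B, #A = k → #B = k → ψ A = ψ B → A = B := by
      intro A B hA hB h
      refine eq_of_upperStar_eq (hA.trans hB.symm) (by omega) ?_
      have h' : (upperStar A).image φ = (upperStar B).image φ := by
        rw [himg A hA, himg B hB, h]
      have hsub : ∀ A B : Finset α, #A = k → #B = k →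
          (upperStar A).image φ = (upperStar B).image φ → upperStar A ⊆ upperStar B := by
        intro A B hA hB h X hX
        obtain ⟨Y, hY, hYX⟩ := mem_image.1 (h ▸ mem_image_of_mem φ hX)
        have := hinj Y X (by rw [(mem_upperStar.1 hY).2, hB]) (by rw [(mem_upperStar.1 hX).2, hA])
          hYX
        exact this ▸ hY
      exact (hsub A B hA hB h').antisymm (hsub B A hB hA h'.symm)
    obtain ⟨σ, hσ⟩ := ih (by omega) ψ (fun A hA => (hψ A hA).1) hψinj (by
      intro A B hA hB hAB
      have hA' : A ∪ B ∈ upperStar A := mem_upperStar.2 ⟨subset_union_left, by omega⟩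
      have hB' : A ∪ B ∈ upperStar B := mem_upperStar.2 ⟨subset_union_right, by omega⟩
      have hle := card_le_card (union_subset ((hψ A hA).2 _ hA') ((hψ B hB).2 _ hB'))
      rw [hc _ hAB] at hle
      by_contra hcon
      have e1 : ψ A = ψ A ∪ ψ B :=
        eq_of_subset_of_card_le subset_union_left (by rw [(hψ A hA).1]; omega)
      have e2 : ψ B = ψ A ∪ ψ B :=
        eq_of_subset_of_card_le subset_union_right (by rw [(hψ B hB).1]; omega)
      have := hψinj A B hA hB (e1.trans e2.symm)
      rw [this, union_self] at hAB
      omega)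
    refine ⟨σ, fun A hA => (eq_of_subset_of_card_le ?_ (by rw [card_map, hc A hA, hA])).symm⟩
    intro y hy
    obtain ⟨x, hx, rfl⟩ := mem_map.1 hy
    obtain ⟨C, hxC, hCA, hC⟩ := exists_subsuperset_card_eq (n := k)
      (singleton_subset_iff.2 hx) (by rw [card_singleton]; exact hk) (by omega)
    have h1 := (hψ C hC).2 A (mem_upperStar.2 ⟨hCA, by omega⟩)
    rw [hσ C hC] at h1
    exact h1 (mem_map_of_mem _ (singleton_subset_iff.1 hxC))

end Johnson

/-! ### Automorphisms and determining sets of Kneser graphs. -/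

section Kneser

variable {n k : ℕ}

lemma kneserGraph_adj_iff (hk : 1 ≤ k) {s t : {s : Finset (Fin n) // #s = k}} :
    (kneserGraph n k).Adj s t ↔ Disjoint s.1 t.1 := by
  refine ⟨fun h => h.2, fun h => ⟨?_, h⟩⟩
  rintro rfl
  have h0 : s.1 = ∅ := by simpa using h
  have := s.2
  rw [h0, card_empty] at this
  omega

/-- This invariant drops strictly once the union exceeds k + 1 points, so automorphisms preserve
Johnson adjacency. -/
lemma ncard_common_neighbors (hk : 1 ≤ k) (s t : {s : Finset (Fin n) // #s = k}) :
    {d | (kneserGraph n k).Adj s d ∧ (kneserGraph n k).Adj t d}.ncard =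
      (n - #(s.1 ∪ t.1)).choose k := by
  have himg : Subtype.val '' {d | (kneserGraph n k).Adj s d ∧ (kneserGraph n k).Adj t d} =
      (powersetCard k (s.1 ∪ t.1)ᶜ : Set (Finset (Fin n))) := by
    ext D
    simp only [kneserGraph_adj_iff hk, Set.mem_image, Set.mem_ofPred_eq, mem_coe, mem_powersetCard,
      subset_compl_iff_disjoint_left, disjoint_union_left]
    constructor
    · rintro ⟨d, hd, rfl⟩
      exact ⟨hd, d.2⟩
    · rintro ⟨hd, hD⟩
      exact ⟨⟨D, hD⟩, hd, rfl⟩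
  rw [← Set.ncard_image_of_injective _ Subtype.val_injective, himg, Set.ncard_coe_finset,
    card_powersetCard, card_compl, Fintype.card_fin]

lemma ncard_common_neighbors_map {V : Type*} {G : SimpleGraph V} (φ : G ≃g G) (s t : V) :
    {d | G.Adj (φ s) d ∧ G.Adj (φ t) d}.ncard = {d | G.Adj s d ∧ G.Adj t d}.ncard := by
  rw [← Set.ncard_image_of_injective {d | G.Adj s d ∧ G.Adj t d} φ.injective]
  congr 1
  ext d
  obtain ⟨e, rfl⟩ := φ.surjective d
  simp [φ.map_adj_iff]

lemma choose_lt_choose_of_lt {m m' k : ℕ} (hk : 1 ≤ k) (hm : k ≤ m) (h : m' < m) :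
    m'.choose k < m.choose k := by
  obtain ⟨m, rfl⟩ : ∃ l, m = l + 1 := ⟨m - 1, by omega⟩
  obtain ⟨k, rfl⟩ : ∃ l, k = l + 1 := ⟨k - 1, by omega⟩
  have h1 := Nat.choose_le_choose (k + 1) (Nat.le_of_lt_succ h)
  have h2 : 0 < m.choose k := Nat.choose_pos (by omega)
  rw [Nat.choose_succ_succ']
  omega

/-- The automorphisms of a Kneser graph are induced by permutations of the ground set. -/
theorem exists_perm_of_kneserGraph_iso (hk : 1 ≤ k) (hn : 2 * k < n)
    (φ : kneserGraph n k ≃g kneserGraph n k) :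
    ∃ σ : Equiv.Perm (Fin n), ∀ v, (φ v).1 = v.1.map σ.toEmbedding := by
  let Φ : Finset (Fin n) → Finset (Fin n) := fun A => if h : #A = k then (φ ⟨A, h⟩).1 else ∅
  have hΦ : ∀ A (h : #A = k), Φ A = (φ ⟨A, h⟩).1 := fun A h => dif_pos h
  have hinj : ∀ A B, #A = k → #B = k → Φ A = Φ B → A = B := by
    intro A B hA hB h
    rw [hΦ A hA, hΦ B hB] at h
    exact congrArg Subtype.val (φ.injective (Subtype.ext h))
  have hcard : ∀ A, #A = k → #(Φ A) = k := fun A hA => by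
    rw [hΦ A hA]
    exact (φ ⟨A, hA⟩).2
  obtain ⟨σ, hσ⟩ := exists_perm_of_johnson k hk (by simpa using hn) Φ hcard hinj (by
    intro A B hA hB hAB
    have h := ncard_common_neighbors_map φ ⟨A, hA⟩ ⟨B, hB⟩
    rw [ncard_common_neighbors hk, ncard_common_neighbors hk, ← hΦ A hA, ← hΦ B hB, hAB] at h
    have hge : k + 1 ≤ #(Φ A ∪ Φ B) := by
      by_contra hcon
      have e1 : Φ A = Φ A ∪ Φ B :=
        eq_of_subset_of_card_le subset_union_left (by rw [hcard A hA]; omega)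
      have e2 : Φ B = Φ A ∪ Φ B :=
        eq_of_subset_of_card_le subset_union_right (by rw [hcard B hB]; omega)
      have := hinj A B hA hB (e1.trans e2.symm)
      rw [this, union_self] at hAB
      omega
    by_contra hne
    have := choose_lt_choose_of_lt hk (m := n - (k + 1)) (m' := n - #(Φ A ∪ Φ B)) (by omega)
      (by omega)
    omega)
  exact ⟨σ, fun v => by rw [← hσ v.1 v.2, hΦ v.1 v.2]⟩

/-- The automorphism of the Kneser graph induced by a permutation of the ground set. -/
def kneserGraphIsoOfPerm (σ : Equiv.Perm (Fin n)) : kneserGraph n k ≃g kneserGraph n k where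
  toFun v := ⟨v.1.map σ.toEmbedding, by rw [card_map]; exact v.2⟩
  invFun v := ⟨v.1.map σ.symm.toEmbedding, by rw [card_map]; exact v.2⟩
  left_inv v := by
    apply Subtype.ext
    ext x
    simp
  right_inv v := by
    apply Subtype.ext
    ext x
    simp
  map_rel_iff' {s t} := by
    simp [kneserGraph, Subtype.ext_iff]

/-- A set of vertices of a Kneser graph is determining iff it separates the points. -/
theorem isDeterminingSet_kneserGraph_iff (hk : 1 ≤ k) (hn : 2 * k < n)
    (S : Set {s : Finset (Fin n) // #s = k}) :
    IsDeterminingSet (kneserGraph n k) S ↔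
      ∀ x y, (∀ v ∈ S, x ∈ v.1 ↔ y ∈ v.1) → x = y := by
  constructor
  · intro hS x y hxy
    by_contra hne
    -- Transposing two unseparated points fixes every member of S.
    have hfix : ∀ v ∈ S, kneserGraphIsoOfPerm (Equiv.swap x y) v = v := by
      intro v hv
      apply Subtype.ext
      change v.1.map (Equiv.swap x y).toEmbedding = v.1
      ext z
      rw [mem_map_equiv, Equiv.symm_swap, Equiv.swap_apply_def]
      have := hxy v hv
      split_ifs with h1 h2
      · rw [h1, this]
      · rw [h2, this]
      · rfl
    obtain ⟨v, hxv, hvy, hv⟩ := exists_subsuperset_card_eq (n := k)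
      (s := {x}) (t := univ.erase y) (by simpa using hne) (by simpa using hk)
      (by rw [card_erase_of_mem (mem_univ y), card_univ, Fintype.card_fin]; omega)
    have h1 : v.map (Equiv.swap x y).toEmbedding = v :=
      congrArg Subtype.val (hS (kneserGraphIsoOfPerm (Equiv.swap x y)) hfix ⟨v, hv⟩)
    have h2 : y ∈ v := by
      rw [← h1, mem_map_equiv, Equiv.symm_swap, Equiv.swap_apply_right]
      exact singleton_subset_iff.1 hxv
    exact (mem_erase.1 (hvy h2)).1 rfl
  · intro hS φ hφ v
    obtain ⟨σ, hσ⟩ := exists_perm_of_kneserGraph_iso hk hn φ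
    have hid : ∀ x, σ x = x := fun x => by
      refine hS _ _ fun v hv => ?_
      have h := hσ v
      rw [hφ v hv] at h
      constructor
      · intro hx
        rw [h, mem_map_equiv, Equiv.symm_apply_apply] at hx
        exact hx
      · intro hx
        rw [h, mem_map_equiv, Equiv.symm_apply_apply]
        exact hx
    apply Subtype.ext
    rw [hσ v]
    have : σ = Equiv.refl _ := Equiv.ext hid
    rw [this]
    ext x
    simp

lemma determiningNumber_le_iff_exists_finset {V : Type*} [Finite V] (G : SimpleGraph V) (r : ℕ) :
    determiningNumber G ≤ r ↔ ∃ S : Finset V, IsDeterminingSet G (S : Set V) ∧ #S ≤ r := by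
  have := Fintype.ofFinite V
  constructor
  · intro h
    obtain ⟨S, hS, hc⟩ := Nat.sInf_mem
      (s := {m : ℕ | ∃ S : Finset V, IsDeterminingSet G (S : Set V) ∧ S.card = m})
      ⟨_, univ, fun φ h v => h v (by simp), rfl⟩
    exact ⟨S, hS, hc.le.trans h⟩
  · rintro ⟨S, hS, hc⟩
    exact (show determiningNumber G ≤ #S from Nat.sInf_le ⟨S, hS, rfl⟩).trans hc

theorem determiningNumber_kneserGraph_le_iff (hk : 1 ≤ k) (hn : 2 * k < n) (r : ℕ) :
    determiningNumber (kneserGraph n k) ≤ r ↔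
      ∃ A : Fin r → Finset (Fin n), (∀ i, #(A i) = k) ∧
        ∀ x y, (∀ i, x ∈ A i ↔ y ∈ A i) → x = y := by
  rw [determiningNumber_le_iff_exists_finset]
  simp only [isDeterminingSet_kneserGraph_iff hk hn]
  constructor
  · rintro ⟨S, hS, hc⟩
    obtain ⟨v₀, -, hv₀⟩ := exists_subset_card_eq (s := (univ : Finset (Fin n))) (n := k)
      (by rw [card_univ, Fintype.card_fin]; omega)
    -- S may have fewer than r members; the list is padded with an arbitrary vertex.
    refine ⟨fun i => (S.toList.getD i ⟨v₀, hv₀⟩).1, fun i => (S.toList.getD i ⟨v₀, hv₀⟩).2, ?_⟩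
    intro x y hxy
    refine hS x y fun v hv => ?_
    obtain ⟨i, hi, hiv⟩ := List.getElem_of_mem (mem_toList.2 hv)
    have := hxy ⟨i, by rw [length_toList] at hi; omega⟩
    dsimp only at this
    rwa [List.getD_eq_getElem _ _ hi, hiv] at this
  · rintro ⟨A, hA, hsep⟩
    refine ⟨univ.image fun i => ⟨A i, hA i⟩, fun x y hxy => hsep x y fun i => ?_, ?_⟩
    · exact hxy ⟨A i, hA i⟩ (by simp)
    · exact card_image_le.trans (by simp)

end Kneser

/-! ### Dual hypergraphs and degree balancing. -/

section Hypergraph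

/-- Point-separating families of `r` sets of size `k` in an `n`-set are dual to `k`-regular
hypergraphs with `n` distinct edges on `r` vertices. -/
theorem exists_separating_iff_exists_regular {n k r : ℕ} :
    (∃ A : Fin r → Finset (Fin n), (∀ i, #(A i) = k) ∧
        ∀ x y, (∀ i, x ∈ A i ↔ y ∈ A i) → x = y) ↔
      ∃ F : Finset (Finset (Fin r)), #F = n ∧ ∀ i, #{S ∈ F | i ∈ S} = k := by
  constructor
  · rintro ⟨A, hA, hsep⟩
    have hinj : Function.Injective fun x : Fin n => ({i | x ∈ A i} : Finset (Fin r)) := by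
      intro x y hxy
      refine hsep x y fun i => ?_
      have := congrArg (i ∈ ·) hxy
      simpa using this
    refine ⟨univ.image fun x => ({i | x ∈ A i} : Finset (Fin r)), ?_, fun i => ?_⟩
    · rw [card_image_of_injective _ hinj, card_univ, Fintype.card_fin]
    · rw [filter_image, card_image_of_injective _ hinj, ← hA i]
      congr 1
      ext x
      simp
  · rintro ⟨F, hF, hreg⟩
    let e := F.equivFinOfCardEq hF
    refine ⟨fun i => {x | i ∈ (e.symm x).1}, fun i => ?_, fun x y hxy => ?_⟩
    · rw [← hreg i]
      refine card_bij (fun x _ => (e.symm x).1) ?_ ?_ ?_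
      · intro x hx
        exact mem_filter.2 ⟨(e.symm x).2, (mem_filter.1 hx).2⟩
      · intro x _ y _ h
        exact e.symm.injective (Subtype.ext h)
      · intro S hS
        refine ⟨e ⟨S, (mem_filter.1 hS).1⟩, ?_, ?_⟩
        · simpa using (mem_filter.1 hS).2
        · simp
    · refine e.symm.injective (Subtype.ext ?_)
      ext i
      simpa using hxy i

variable {α : Type*} [DecidableEq α]

lemma sum_card_eq_sum_degree [Fintype α] (F : Finset (Finset α)) :
    ∑ S ∈ F, #S = ∑ i, #{S ∈ F | i ∈ S} := by
  simp only [card_filter]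
  rw [sum_comm]
  refine sum_congr rfl fun S _ => ?_
  simp

lemma sum_replace {F : Finset (Finset α)} {S T : Finset α} (hS : S ∈ F) (hT : T ∉ F)
    (f : Finset α → ℕ) :
    ∑ X ∈ insert T (F.erase S), f X + f S = ∑ X ∈ F, f X + f T := by
  rw [sum_insert (fun h => hT (mem_of_mem_erase h)), ← add_sum_erase F f hS]
  ring

lemma card_replace {F : Finset (Finset α)} {S T : Finset α} (hS : S ∈ F) (hT : T ∉ F) :
    #(insert T (F.erase S)) = #F := by
  rw [card_insert_of_notMem (fun h => hT (mem_of_mem_erase h)), card_erase_add_one hS]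

lemma degree_replace {F : Finset (Finset α)} {S T : Finset α} (hS : S ∈ F) (hT : T ∉ F) (i : α) :
    #{X ∈ insert T (F.erase S) | i ∈ X} + (if i ∈ S then 1 else 0) =
      #{X ∈ F | i ∈ X} + if i ∈ T then 1 else 0 := by
  simp only [card_filter]
  exact sum_replace hS hT fun X => if i ∈ X then 1 else 0

lemma exists_map_swap_notMem {F : Finset (Finset α)} {x y : α}
    (h : #{S ∈ F | y ∈ S} < #{S ∈ F | x ∈ S}) :
    ∃ S ∈ F, x ∈ S ∧ S.map (Equiv.swap x y).toEmbedding ∉ F := by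
  by_contra! hcon
  refine h.not_ge (card_le_card_of_injOn (fun S => S.map (Equiv.swap x y).toEmbedding) ?_
    (map_injective _).injOn)
  intro S hS
  have hS := mem_filter.1 hS
  refine mem_filter.2 ⟨hcon S hS.1 hS.2, ?_⟩
  rw [mem_map_equiv, Equiv.symm_swap, Equiv.swap_apply_right]
  exact hS.2

lemma exists_insert_notMem {F : Finset (Finset α)} {y : α}
    (h : 2 * #{S ∈ F | y ∈ S} < #F) : ∃ S ∈ F, y ∉ S ∧ insert y S ∉ F := by
  by_contra! hcon
  have hle : #{S ∈ F | y ∉ S} ≤ #{S ∈ F | y ∈ S} := by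
    refine card_le_card_of_injOn (fun S => insert y S) ?_ ?_
    · intro S hS
      have hS := mem_filter.1 hS
      exact mem_filter.2 ⟨hcon S hS.1 hS.2, mem_insert_self _ _⟩
    · intro S hS T hT hST
      have hS := (mem_filter.1 hS).2
      have hT := (mem_filter.1 hT).2
      rw [← erase_insert hS, ← erase_insert hT]
      exact congrArg (fun X => erase X y) hST
  have := card_filter_add_card_filter_not (s := F) (fun S => y ∈ S)
  omega

/-- A family of `n > 2k` distinct subsets whose average degree is at most `k` can be turned into a
`k`-regular one of the same cardinality. -/
theorem exists_regular_of_sum_card_le [Fintype α] {n k : ℕ} (hn : 2 * k < n)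
    {F : Finset (Finset α)} (hF : #F = n) (hsum : ∑ S ∈ F, #S ≤ k * Fintype.card α) :
    ∃ F : Finset (Finset α), #F = n ∧ ∀ i, #{S ∈ F | i ∈ S} = k := by
  -- In a family minimising the squared deviation of the degrees from k, any irregularity allows one
  -- replacement that lowers the deviation.
  obtain ⟨G, hG, hmin⟩ := exists_min_image
    {F : Finset (Finset α) | #F = n ∧ ∑ S ∈ F, #S ≤ k * Fintype.card α}
    (fun F => ∑ i, ((#{S ∈ F | i ∈ S} : ℤ) - k) ^ 2) ⟨F, by simp [hF, hsum]⟩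
  simp only [mem_filter, mem_univ, true_and] at hG hmin
  obtain ⟨hGn, hGsum⟩ := hG
  refine ⟨G, hGn, ?_⟩
  by_contra! hcon
  obtain ⟨y, hy⟩ : ∃ y, #{S ∈ G | y ∈ S} < k := by
    by_contra! hge
    obtain ⟨i, hi⟩ := hcon
    have : ∑ _i : α, k < ∑ i, #{S ∈ G | i ∈ S} :=
      sum_lt_sum (fun i _ => hge i) ⟨i, mem_univ i, lt_of_le_of_ne (hge i) (Ne.symm hi)⟩
    rw [← sum_card_eq_sum_degree, sum_const, card_univ, smul_eq_mul, mul_comm] at this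
    omega
  -- If some degree exceeds k, one unit moves from x to y at constant total size. Otherwise the
  -- total is strictly below the bound, so y can be added to some set.
  by_cases hx : ∃ x, k < #{S ∈ G | x ∈ S}
  · obtain ⟨x, hx⟩ := hx
    obtain ⟨S, hS, hxS, hT⟩ := exists_map_swap_notMem (hy.trans hx)
    have hyS : y ∉ S := by
      intro hyS
      refine hT ?_
      convert hS
      ext z
      rw [mem_map_equiv, Equiv.symm_swap, Equiv.swap_apply_def]
      split_ifs with h1 h2
      · simp [h1, hxS, hyS]
      · simp [h2, hxS, hyS]
      · rfl
    have hmem : ∀ i, i ∈ S.map (Equiv.swap x y).toEmbedding ↔ Equiv.swap x y i ∈ S := fun i => by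
      rw [mem_map_equiv, Equiv.symm_swap]
    have hd := fun i => degree_replace hS hT i
    have hw := sum_replace hS hT card
    rw [card_map] at hw
    refine (hmin _ ⟨(card_replace hS hT).trans hGn, by omega⟩).not_gt ?_
    have hlt : ∀ i, i = x → ((#{X ∈ insert (S.map (Equiv.swap x y).toEmbedding) (G.erase S) |
        i ∈ X} : ℤ) - k) ^ 2 < ((#{X ∈ G | i ∈ X} : ℤ) - k) ^ 2 := by
      rintro i rfl
      have := hd i
      rw [if_pos hxS, if_neg (by rw [hmem, Equiv.swap_apply_left]; exact hyS)] at this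
      zify at this hx
      nlinarith
    refine sum_lt_sum (fun i _ => ?_) ⟨x, mem_univ x, hlt x rfl⟩
    by_cases hix : i = x
    · exact (hlt i hix).le
    by_cases hiy : i = y
    · subst hiy
      have := hd i
      rw [if_neg hyS, if_pos (by rw [hmem, Equiv.swap_apply_right]; exact hxS)] at this
      zify at this hy
      nlinarith
    · have := hd i
      simp only [hmem, Equiv.swap_apply_of_ne_of_ne hix hiy, Nat.add_right_cancel_iff] at this
      rw [this]
  · push Not at hx
    obtain ⟨S, hS, hyS, hT⟩ := exists_insert_notMem (F := G) (y := y) (by omega)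
    have hd := fun i => degree_replace hS hT i
    have hw := sum_replace hS hT card
    rw [card_insert_of_notMem hyS] at hw
    have hlt : ∑ i, #{S ∈ G | i ∈ S} < ∑ _i : α, k :=
      sum_lt_sum (fun i _ => hx i) ⟨y, mem_univ y, hy⟩
    rw [← sum_card_eq_sum_degree, sum_const, card_univ, smul_eq_mul, mul_comm] at hlt
    refine (hmin _ ⟨(card_replace hS hT).trans hGn, by omega⟩).not_gt ?_
    have hlt : ∀ i, i = y → ((#{X ∈ insert (insert y S) (G.erase S) |
        i ∈ X} : ℤ) - k) ^ 2 < ((#{X ∈ G | i ∈ X} : ℤ) - k) ^ 2 := by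
      rintro i rfl
      have := hd i
      rw [if_neg hyS, if_pos (mem_insert_self _ _)] at this
      zify at this hy
      nlinarith
    refine sum_lt_sum (fun i _ => ?_) ⟨y, mem_univ y, hlt y rfl⟩
    by_cases hiy : i = y
    · exact (hlt i hiy).le
    · have := hd i
      simp only [mem_insert, hiy, false_or, Nat.add_right_cancel_iff] at this
      rw [this]

theorem determiningNumber_kneserGraph_le_iff_sum_card_le {n k : ℕ} (hk : 1 ≤ k) (hn : 2 * k < n)
    (r : ℕ) :
    determiningNumber (kneserGraph n k) ≤ r ↔
      ∃ F : Finset (Finset (Fin r)), #F = n ∧ ∑ S ∈ F, #S ≤ k * r := by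
  rw [determiningNumber_kneserGraph_le_iff hk hn, exists_separating_iff_exists_regular]
  constructor
  · rintro ⟨F, hF, hreg⟩
    refine ⟨F, hF, ?_⟩
    rw [sum_card_eq_sum_degree]
    simp [hreg, mul_comm]
  · rintro ⟨F, hF, hsum⟩
    exact exists_regular_of_sum_card_le hn hF (by simpa using hsum)

end Hypergraph

/-! ### Least total size of n subsets of an r-set. -/

section MinimalWeight

/-- The number of subsets of an `r`-set with fewer than `w` elements. -/
def numCardLT (r w : ℕ) : ℕ := ∑ v ∈ range w, r.choose v

/-- The sum of the cardinalities of the subsets of an `r`-set with fewer than `w` elements. -/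
def weightCardLT (r w : ℕ) : ℕ := ∑ v ∈ range w, r.choose v * v

lemma sum_finset_apply_card {r w : ℕ} (hw : w ≤ r + 1) (f : ℕ → ℕ) (hf : ∀ v, w ≤ v → f v = 0) :
    ∑ S : Finset (Fin r), f #S = ∑ v ∈ range w, r.choose v * f v := by
  rw [← powerset_univ, sum_powerset_apply_card, card_univ, Fintype.card_fin]
  symm
  refine sum_subset (range_subset_range.2 hw) fun v _ hv => ?_
  rw [hf v (by simpa using hv), mul_zero]

lemma sum_card_lt_apply_card {r w : ℕ} (hw : w ≤ r + 1) (f : ℕ → ℕ) :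
    ∑ S : Finset (Fin r) with #S < w, f #S = ∑ v ∈ range w, r.choose v * f v := by
  rw [sum_filter, sum_finset_apply_card hw (fun v => if v < w then f v else 0)
    (fun v hv => if_neg (by omega))]
  exact sum_congr rfl fun v hv => by rw [if_pos (mem_range.1 hv)]

/-- For the lower bound, |S| ≥ w - max(w - |S|, 0), and the deficits sum to at most their total over
all subsets. Equality holds for all sets below level w together with j sets on level w. -/
theorem exists_card_eq_sum_card_le_iff {r w j : ℕ} (hw : w ≤ r) (hj : j ≤ r.choose w) (m : ℕ) :
    (∃ F : Finset (Finset (Fin r)), #F = numCardLT r w + j ∧ ∑ S ∈ F, #S ≤ m) ↔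
      weightCardLT r w + j * w ≤ m := by
  constructor
  · rintro ⟨F, hF, hsum⟩
    have h1 : #F * w ≤ ∑ S ∈ F, #S + ∑ S ∈ F, (w - #S) := by
      rw [← sum_add_distrib, ← smul_eq_mul, ← sum_const]
      exact sum_le_sum fun S _ => by omega
    have h2 : ∑ S ∈ F, (w - #S) ≤ ∑ v ∈ range w, r.choose v * (w - v) := by
      rw [← sum_finset_apply_card (by omega) (fun v => w - v) (fun v hv => by omega)]
      exact sum_le_sum_of_subset (subset_univ F)
    have h3 : weightCardLT r w + ∑ v ∈ range w, r.choose v * (w - v) = numCardLT r w * w := by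
      rw [weightCardLT, numCardLT, ← sum_add_distrib, sum_mul]
      refine sum_congr rfl fun v hv => ?_
      rw [← mul_add, Nat.add_sub_cancel' (mem_range.1 hv).le]
    rw [hF, add_mul] at h1
    omega
  · intro h
    obtain ⟨T, hT, hTj⟩ := exists_subset_card_eq
      (s := powersetCard w (univ : Finset (Fin r))) (n := j) (by simpa using hj)
    have hTw : ∀ S ∈ T, #S = w := fun S hS => (mem_powersetCard.1 (hT hS)).2
    have hdisj : Disjoint (univ.filter fun S : Finset (Fin r) => #S < w) T := by
      rw [disjoint_left]
      intro S hS hST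
      have := (mem_filter.1 hS).2
      rw [hTw S hST] at this
      omega
    refine ⟨univ.filter (fun S => #S < w) ∪ T, ?_, ?_⟩
    · rw [card_union_of_disjoint hdisj, hTj, card_eq_sum_ones,
        sum_card_lt_apply_card (by omega) fun _ => 1]
      simp [numCardLT]
    · rw [sum_union hdisj, sum_card_lt_apply_card (by omega) fun v => v, sum_congr rfl hTw,
        sum_const, hTj, smul_eq_mul]
      exact h

/-- The sum telescopes, since (r - v) C(r, v) = (v + 1) C(r, v + 1). -/
lemma sum_range_sub_two_mul_choose {r w : ℕ} (hw : w ≤ r + 1) :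
    ∑ v ∈ range w, ((r : ℤ) - 2 * v) * r.choose v = w * r.choose w := by
  induction w with
  | zero => simp
  | succ w ih =>
    rw [sum_range_succ, ih (by omega)]
    have h := Nat.choose_succ_right_eq r w
    zify [show w ≤ r by omega] at h
    push_cast
    linear_combination -h

lemma mul_numCardLT_sub {r w : ℕ} (hw : w ≤ r) :
    (r : ℤ) * numCardLT r w - 2 * weightCardLT r w = w * r.choose w := by
  rw [← sum_range_sub_two_mul_choose (by omega), numCardLT, weightCardLT]
  push_cast
  rw [mul_sum, mul_sum, ← sum_sub_distrib]
  exact sum_congr rfl fun v _ => by ring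

lemma numCardLT_succ_self (r : ℕ) : numCardLT r (r + 1) = 2 ^ r :=
  Nat.sum_range_choose r

lemma sum_range_numCardLT {M : Type*} [AddCommMonoid M] (r W : ℕ) (f : ℕ → M) :
    ∑ i ∈ range (numCardLT r W), f i =
      ∑ w ∈ range W, ∑ j ∈ range (r.choose w), f (numCardLT r w + j) := by
  induction W with
  | zero => simp [numCardLT]
  | succ W ih =>
    rw [sum_range_succ, ← ih, ← sum_range_add]
    congr 2
    exact sum_range_succ _ _

/-- With c = C(r, w), twice the inner sum is r c² + (r - 2w) c. Over all w the second term
telescopes to zero and the squares sum to C(2r, r). -/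
lemma two_mul_sum_excess (r : ℕ) :
    2 * ∑ w ∈ range (r + 1), ∑ j ∈ range (r.choose w),
      ((w : ℤ) * r.choose w + (j + 1) * (r - 2 * w)) = r * r.centralBinom := by
  have hid : ∀ c : ℕ, 2 * ∑ j ∈ range c, ((j : ℤ) + 1) = c * (c + 1) := fun c => by
    induction c with
    | zero => simp
    | succ c ih => rw [sum_range_succ, mul_add, ih]; push_cast; ring
  have h1 : ∀ w ∈ range (r + 1), 2 * ∑ j ∈ range (r.choose w),
      ((w : ℤ) * r.choose w + (j + 1) * (r - 2 * w)) =
      r * (r.choose w : ℤ) ^ 2 + ((r : ℤ) - 2 * w) * r.choose w := fun w _ => by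
    rw [sum_add_distrib, sum_const, card_range, nsmul_eq_mul, ← sum_mul]
    linear_combination ((r : ℤ) - 2 * w) * hid (r.choose w)
  rw [mul_sum, sum_congr rfl h1, sum_add_distrib, sum_range_sub_two_mul_choose le_rfl,
    Nat.choose_succ_self, ← mul_sum]
  have h2 := Nat.sum_range_choose_sq r
  rw [Nat.centralBinom, ← h2]
  push_cast
  ring

end MinimalWeight

/-! ### Counting parameters and growth of the count. -/

section Counting

/-- The interval m/r ≤ k < n/2 has length (rn - 2m)/(2r); rounding and k ≥ 1 change the count by at
most 1/2 upwards and 2 downwards. -/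
lemma card_filter_bounds {r n m K : ℕ} (hr : 1 ≤ r) (hn : n ≤ K) (hm : 2 * m ≤ r * n) :
    2 * r * #{k ∈ range K | 1 ≤ k ∧ 2 * k < n ∧ m ≤ k * r} + 2 * m ≤ r * n + r ∧
      r * n ≤ 2 * m + 2 * r * #{k ∈ range K | 1 ≤ k ∧ 2 * k < n ∧ m ≤ k * r} + 4 * r := by
  -- a is m/r rounded up.
  obtain ⟨a, ha1, ha2⟩ : ∃ a, m ≤ a * r ∧ a * r < m + r := by
    refine ⟨(m + r - 1) / r, ?_, ?_⟩
    · have h1 := Nat.div_add_mod (m + r - 1) r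
      have h2 := Nat.mod_lt (m + r - 1) hr
      rw [mul_comm] at h1
      omega
    · have h1 := Nat.div_mul_le_self (m + r - 1) r
      omega
  have hset : {k ∈ range K | 1 ≤ k ∧ 2 * k < n ∧ m ≤ k * r} = Ico (max 1 a) ((n + 1) / 2) := by
    ext k
    have hka : m ≤ k * r ↔ a ≤ k := by
      constructor
      · intro h
        by_contra! hlt
        have := Nat.mul_le_mul_right r (Nat.succ_le_of_lt hlt)
        rw [Nat.succ_mul] at this
        omega
      · exact fun h => ha1.trans (Nat.mul_le_mul_right r h)
    rw [mem_filter, mem_range, mem_Ico, hka]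
    omega
  rw [hset, Nat.card_Ico]
  obtain ⟨c, hc⟩ : ∃ c, c = (n + 1) / 2 - max 1 a := ⟨_, rfl⟩
  rw [← hc]
  constructor
  · rcases Nat.eq_zero_or_pos c with h0 | h0
    · rw [h0]; omega
    · have h1 : 2 * c + 2 * a ≤ n + 1 := by omega
      have h2 := Nat.mul_le_mul_left r h1
      linarith
  · have h1 : n ≤ 2 * c + 2 * a + 2 := by omega
    have h2 := Nat.mul_le_mul_left r h1
    linarith

/-- The parameters of the Kneser graphs with determining number at most `r`. -/
def kneserWithDetLE (r : ℕ) : Set (ℕ × ℕ) :=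
  {p | 1 ≤ p.2 ∧ 2 * p.2 < p.1 ∧ determiningNumber (kneserGraph p.1 p.2) ≤ r}

open Classical in
lemma kneserWithDetLE_eq (r : ℕ) : kneserWithDetLE r =
    (((range (2 ^ r + 1)) ×ˢ (range (2 ^ r + 1))).filter (· ∈ kneserWithDetLE r) :
      Finset (ℕ × ℕ)) := by
  ext ⟨n, k⟩
  simp only [coe_filter, mem_product, mem_range, Set.mem_ofPred_eq, iff_and_self]
  rintro ⟨hk, hn, hd⟩
  obtain ⟨F, hF, -⟩ := (determiningNumber_kneserGraph_le_iff_sum_card_le hk hn r).1 hd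
  have : n ≤ 2 ^ r := by
    rw [← show #F = n from hF]
    exact (card_le_univ F).trans (by simp)
  simp only at hn
  omega

lemma finite_kneserWithDetLE (r : ℕ) : (kneserWithDetLE r).Finite := by
  rw [kneserWithDetLE_eq]
  exact finite_toSet _

open Classical in
lemma ncard_kneserWithDetLE (r : ℕ) : (kneserWithDetLE r).ncard =
    ∑ n ∈ range (2 ^ r), #{k ∈ range (2 ^ r + 1) | (n + 1, k) ∈ kneserWithDetLE r} := by
  rw [kneserWithDetLE_eq, Set.ncard_coe_finset, card_filter, sum_product, sum_range_succ',
    sum_eq_zero (s := range (2 ^ r + 1)) (f := fun k => if (0, k) ∈ kneserWithDetLE r then 1 else 0),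
    ← kneserWithDetLE_eq]
  · simp only [card_filter, add_zero]
  · intro k _
    exact if_neg fun h => Nat.not_lt_zero _ h.2.1

open Classical in
-- The middle expression is rn - 2m for n = `numCardLT r w + j + 1` and m its least total size.
lemma card_kneserWithDetLE_fiber_bounds {r w j : ℕ} (hr : 1 ≤ r) (hw : w ≤ r)
    (hj : j < r.choose w) :
    2 * (r : ℤ) * #{k ∈ range (2 ^ r + 1) | (numCardLT r w + j + 1, k) ∈ kneserWithDetLE r} ≤
        (w : ℤ) * r.choose w + (j + 1) * (r - 2 * w) + r ∧
      (w : ℤ) * r.choose w + (j + 1) * (r - 2 * w) ≤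
        2 * (r : ℤ) * #{k ∈ range (2 ^ r + 1) | (numCardLT r w + j + 1, k) ∈ kneserWithDetLE r} +
          4 * r := by
  have hset : {k ∈ range (2 ^ r + 1) | (numCardLT r w + j + 1, k) ∈ kneserWithDetLE r} =
      {k ∈ range (2 ^ r + 1) | 1 ≤ k ∧ 2 * k < numCardLT r w + j + 1 ∧
        weightCardLT r w + (j + 1) * w ≤ k * r} := by
    refine filter_congr fun k _ => ?_
    refine and_congr_right fun hk => and_congr_right fun hn => ?_
    exact (determiningNumber_kneserGraph_le_iff_sum_card_le hk hn r).trans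
      (exists_card_eq_sum_card_le_iff hw hj (k * r))
  have hg := mul_numCardLT_sub hw
  have hg0 : (0 : ℤ) ≤ (w : ℤ) * r.choose w + (j + 1) * (r - 2 * w) := by
    have hj' : (j : ℤ) + 1 ≤ r.choose w := by exact_mod_cast hj
    have hw' : (w : ℤ) ≤ r := by exact_mod_cast hw
    nlinarith [mul_nonneg (sub_nonneg.2 hj') (Nat.cast_nonneg (α := ℤ) w),
      mul_nonneg (sub_nonneg.2 hw') (show (0 : ℤ) ≤ j + 1 by positivity)]
  have hle : numCardLT r w + j + 1 ≤ 2 ^ r + 1 := by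
    rw [← numCardLT_succ_self]
    have h1 : numCardLT r (w + 1) ≤ numCardLT r (r + 1) :=
      sum_le_sum_of_subset (range_subset_range.2 (by omega))
    have h2 : numCardLT r (w + 1) = numCardLT r w + r.choose w := sum_range_succ _ _
    omega
  have hb := card_filter_bounds (m := weightCardLT r w + (j + 1) * w) hr hle (by
    zify
    linarith)
  rw [hset]
  generalize #{k ∈ range (2 ^ r + 1) | 1 ≤ k ∧ 2 * k < numCardLT r w + j + 1 ∧
    weightCardLT r w + (j + 1) * w ≤ k * r} = c at hb ⊢
  zify at hb
  constructor <;> linarith [hb.1, hb.2]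

theorem four_mul_ncard_kneserWithDetLE_bounds {r : ℕ} (hr : 1 ≤ r) :
    4 * (kneserWithDetLE r).ncard ≤ r.centralBinom + 2 * 2 ^ r ∧
      r.centralBinom ≤ 4 * (kneserWithDetLE r).ncard + 8 * 2 ^ r := by
  classical
  have hsum := two_mul_sum_excess r
  have hones : ∑ w ∈ range (r + 1), ∑ _j ∈ range (r.choose w), (r : ℤ) = r * 2 ^ r := by
    rw [← sum_range_numCardLT r (r + 1) (fun _ => (r : ℤ)), numCardLT_succ_self]
    simp [mul_comm]
  have hN : 2 * (r : ℤ) * (kneserWithDetLE r).ncard = ∑ w ∈ range (r + 1),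
      ∑ j ∈ range (r.choose w), 2 * (r : ℤ) *
        #{k ∈ range (2 ^ r + 1) | (numCardLT r w + j + 1, k) ∈ kneserWithDetLE r} := by
    rw [ncard_kneserWithDetLE, ← numCardLT_succ_self, sum_range_numCardLT]
    push_cast
    simp only [mul_sum]
  have hup : 2 * (r : ℤ) * (kneserWithDetLE r).ncard ≤ ∑ w ∈ range (r + 1),
      ∑ j ∈ range (r.choose w), ((w : ℤ) * r.choose w + (j + 1) * (r - 2 * w)) + r * 2 ^ r := by
    rw [hN, ← hones]
    simp only [← sum_add_distrib]
    exact sum_le_sum fun w hw => sum_le_sum fun j hj =>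
      (card_kneserWithDetLE_fiber_bounds hr (Nat.le_of_lt_succ (mem_range.1 hw))
        (mem_range.1 hj)).1
  have hlo : ∑ w ∈ range (r + 1), ∑ j ∈ range (r.choose w),
      ((w : ℤ) * r.choose w + (j + 1) * (r - 2 * w)) ≤
        2 * (r : ℤ) * (kneserWithDetLE r).ncard + 4 * (r * 2 ^ r) := by
    rw [hN, ← hones]
    simp only [mul_sum, ← sum_add_distrib]
    exact sum_le_sum fun w hw => sum_le_sum fun j hj =>
      (card_kneserWithDetLE_fiber_bounds hr (Nat.le_of_lt_succ (mem_range.1 hw))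
        (mem_range.1 hj)).2
  have hr0 : (0 : ℤ) < r := by exact_mod_cast hr
  zify
  constructor <;> refine le_of_mul_le_mul_left ?_ hr0 <;> linarith

lemma mul_le_two_pow {r : ℕ} (hr : 10 ≤ r) : 88 * r ≤ 2 ^ r := by
  induction r, hr using Nat.le_induction with
  | base => norm_num
  | succ r hr ih => rw [pow_succ]; omega

lemma mul_two_pow_le_centralBinom {r : ℕ} (hr : 10 ≤ r) : 44 * 2 ^ r ≤ r.centralBinom := by
  have h1 := Nat.four_pow_le_two_mul_self_mul_centralBinom r (by omega)
  have h2 := Nat.mul_le_mul_right (2 ^ r) (mul_le_two_pow hr)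
  rw [← mul_pow] at h2
  refine Nat.le_of_mul_le_mul_left (c := 2 * r) ?_ (by omega)
  norm_num at h2
  linarith

/-- The central binomial coefficient grows by at least 7/2 per step. The spare half must absorb the
errors 6 · 2^r and 8 · 2^(r+1), that is 22 · 2^r, hence the constant 44. -/
lemma three_mul_ncard_kneserWithDetLE_le {r : ℕ} (hr : 10 ≤ r) :
    3 * (kneserWithDetLE r).ncard ≤ (kneserWithDetLE (r + 1)).ncard := by
  have h1 := (four_mul_ncard_kneserWithDetLE_bounds (show 1 ≤ r by omega)).1
  have h2 := (four_mul_ncard_kneserWithDetLE_bounds (show 1 ≤ r + 1 by omega)).2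
  have h3 := mul_two_pow_le_centralBinom hr
  have h4 := Nat.succ_mul_centralBinom_succ r
  have h5 : 7 * r.centralBinom ≤ 2 * (r + 1).centralBinom := by
    refine Nat.le_of_mul_le_mul_left (c := r + 1) ?_ (by omega)
    nlinarith [Nat.mul_le_mul_right r.centralBinom hr]
  rw [pow_succ] at h2
  omega

lemma numKneserWithDet_succ_add (r : ℕ) :
    numKneserWithDet (r + 1) + (kneserWithDetLE r).ncard = (kneserWithDetLE (r + 1)).ncard := by
  have hd : kneserWithDet (r + 1) = kneserWithDetLE (r + 1) \ kneserWithDetLE r := by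
    ext p
    simp only [kneserWithDet, kneserWithDetLE, Set.mem_sdiff, Set.mem_ofPred_eq]
    constructor
    · rintro ⟨h1, h2, h3⟩
      exact ⟨⟨h1, h2, h3.le⟩, fun h => by omega⟩
    · rintro ⟨⟨h1, h2, h3⟩, h4⟩
      refine ⟨h1, h2, ?_⟩
      by_contra hne
      exact h4 ⟨h1, h2, by omega⟩
  rw [numKneserWithDet, hd]
  exact Set.ncard_sdiff_add_ncard_of_subset (fun p hp => ⟨hp.1, hp.2.1, hp.2.2.trans r.le_succ⟩)
    (finite_kneserWithDetLE _)

end Counting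

theorem mainTheorem6 :
    (∀ r : ℕ, (kneserWithDet r).Finite) ∧
      ∃ R : ℕ, 3 ≤ R ∧ ∀ r : ℕ, R ≤ r →
        numKneserWithDet (r + 1) + numKneserWithDet (r - 1) ≥ 2 * numKneserWithDet r := by
  refine ⟨fun r => (finite_kneserWithDetLE r).subset fun p hp => ⟨hp.1, hp.2.1, hp.2.2.le⟩,
    10, by norm_num, fun r hr => ?_⟩
  obtain ⟨s, rfl⟩ : ∃ s, r = s + 1 := ⟨r - 1, by omega⟩
  have h1 := three_mul_ncard_kneserWithDetLE_le hr
  have h2 := numKneserWithDet_succ_add (s + 1)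
  have h3 := numKneserWithDet_succ_add s
  rw [Nat.add_sub_cancel]
  omega
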